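/- Assume CH. Call an ultrafilter $\mathcal G$ on $\omega$ selective if it is free (non-principal) and for every sequence $\langle G_n:n\in\omega\rangle$ of elements of $\mathcal G$ there are $m_n\in G_n$ $(n\in\omega)$ with $\{m_n:n\in\omega\}\in\mathcal G$. For a topological space $X$ and a sequence $\langle D_n:n\in\omega\rangle$ of subsets of $X$, consider sequences $\langle F_n:n\in\omega\rangle$ with each $F_n$ a finite subset of $D_n$. The space $X$ is - $M$-separable if for every sequence $\langle D_n\rangle$ of dense subsets of $X$ there is such a sequence $\langle F_n\rangle$ for which $\bigcup_n F_n$ is dense in $X$; - $S$-separable if for every sequence $\langle D_n\rangle$ of dense subsets of $X$ there is such a sequence $\langle F_n\rangle$ with the property that for every finite family $\{U_i:i<k\}$ of non-empty open subsets of $X$ there is $n\in\omega$ with $U_i\cap F_n\neq\emptyset$ for all $i<k$; and $mS$-separable if this holds for all decreasing sequences $\langle D_n\rangle$ of dense subsets of $X$; - $mS_{\mathcal G}$-separable if for every decreasing sequence $\langle D_n\rangle$ of dense subsets of $X$ there is such a sequence $\langle F_n\rangle$ with $\{n\in\omega:U\cap F_n\neq\emptyset\}\in\mathcal G$ for every non-empty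 open $U\subseteq X$. Theorem (CH). For every selective ultrafilter $\mathcal G$ on $\omega$ there is a countable regular ($T_3$, in particular Hausdorff) space without isolated points that is $mS_{\mathcal G}$-separable but not $S$-separable. Moreover, there is a countable regular space without isolated points that is $mS$-separable and $M$-separable but not $S$-separable. -/

import Mathlib

/-- `X` is `M`-separable: from every sequence of dense sets one can select finite subsets whose
union is dense. -/
def MSeparable (X : Type*) [TopologicalSpace X] : Prop :=
  ∀ D : ℕ → Set X, (∀ n, Dense (D n)) →
    ∃ F : ℕ → Finset X, (∀ n, (F n : Set X) ⊆ D n) ∧ Dense (⋃ n, (F n : Set X))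

/-- `F` catches every finite family of non-empty open sets: some single `F n` meets all its
members. -/
def CatchesFiniteFamilies {X : Type*} [TopologicalSpace X] (F : ℕ → Finset X) : Prop :=
  ∀ (k : ℕ) (U : Fin k → Set X), (∀ i, IsOpen (U i) ∧ (U i).Nonempty) →
    ∃ n, ∀ i, (U i ∩ (F n : Set X)).Nonempty

/-- `X` is `S`-separable. -/
def SSeparable (X : Type*) [TopologicalSpace X] : Prop :=
  ∀ D : ℕ → Set X, (∀ n, Dense (D n)) →
    ∃ F : ℕ → Finset X, (∀ n, (F n : Set X) ⊆ D n) ∧ CatchesFiniteFamilies F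

/-- `X` is `mS`-separable: as `S`-separable, for decreasing sequences of dense sets only. -/
def MonoSSeparable (X : Type*) [TopologicalSpace X] : Prop :=
  ∀ D : ℕ → Set X, Antitone D → (∀ n, Dense (D n)) →
    ∃ F : ℕ → Finset X, (∀ n, (F n : Set X) ⊆ D n) ∧ CatchesFiniteFamilies F

/-- `X` is `mS_𝒢`-separable, for a filter `𝒢` on `ℕ`. -/
def MonoSSeparableAlong (𝒢 : Filter ℕ) (X : Type*) [TopologicalSpace X] : Prop :=
  ∀ D : ℕ → Set X, Antitone D → (∀ n, Dense (D n)) →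
    ∃ F : ℕ → Finset X, (∀ n, (F n : Set X) ⊆ D n) ∧
      ∀ U : Set X, IsOpen U → U.Nonempty → {n : ℕ | (U ∩ (F n : Set X)).Nonempty} ∈ 𝒢

/-- A selective ultrafilter on `ℕ`: it is free, and from every sequence of its members one can
select one point each so that the set of the selected points is again a member. -/
def IsSelective (𝒢 : Ultrafilter ℕ) : Prop :=
  (𝒢 : Filter ℕ) ≤ Filter.cofinite ∧
    ∀ G : ℕ → Set ℕ, (∀ n, G n ∈ 𝒢) → ∃ m : ℕ → ℕ, (∀ n, m n ∈ G n) ∧ Set.range m ∈ 𝒢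

/-! One space serves both claims. A countable set is injected into ℝ and split into levels, each
dense there. Under CH a recursion of length at most ω₁ adds clopen sets. For every choice of finite
sets `F m` in the levels it adds a clopen `A` that contains or misses each `F m`, so no `F m` meets
both `A` and `Aᶜ`; the levels, kept dense, then refute `S`-separability. For every decreasing
sequence of dense sets it also fixes finite subsets `H n` that every later basic open set must meet
for almost all `n`.

The two demands are reconciled by `LargeOn`: inside each cell, `H n` has a subset of size at least
`n / c` with injective or bounded levels, so the blocks `F m` can tie together only few of its
points. Colour each block as a unit and all other points separately, at random. By Hoeffding and
Borel–Cantelli (`exists_balanced_coloring`) both colours keep a quarter of each such subset, up to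
finitely many `n`, so largeness survives adding `A` (`IsGood.exists_insert_homogeneous`). -/

/-! ### Random two-colourings -/

open MeasureTheory ProbabilityTheory Filter in
/-- The number of heads among the coins in `q` is at most a quarter with probability exponentially
small in the size of `q`. -/
theorem exists_coin_measure (I : Type*) :
    ∃ μ : Measure (I → Bool), IsProbabilityMeasure μ ∧ ∀ (b : Bool) (q : Finset I),
      μ.real {f | 4 * (q.filter (fun i => f i = b)).card ≤ q.card} ≤
        Real.exp (-(q.card : ℝ) / 8) := by
  classical
  let ν : Measure Bool := (PMF.uniformOfFintype Bool).toMeasure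
  let μ : Measure (I → Bool) := Measure.infinitePi (fun _ : I => ν)
  refine ⟨μ, inferInstance, fun b q => ?_⟩
  -- Centred, with the sign that turns few occurrences of `b` into a large sum: the sum over `q` is
  -- `|q|/2` minus their number, hence the threshold `|q|/4` below.
  let g : Bool → ℝ := fun x => if x = b then -(1 / 2) else 1 / 2
  let Y : I → (I → Bool) → ℝ := fun i f => g (f i)
  have hg : Measurable g := measurable_of_finite g
  have hind : iIndepFun Y μ := iIndepFun_infinitePi (fun _ => hg)
  have hν : ν[g] = 0 := by
    rw [PMF.integral_eq_sum]
    cases b <;> simp [g]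
  have hsub : HasSubgaussianMGF g ((‖(1 / 2 : ℝ) - -(1 / 2)‖₊ / 2) ^ 2) ν := by
    refine hasSubgaussianMGF_of_mem_Icc_of_integral_eq_zero hg.aemeasurable
      (Eventually.of_forall fun x => ?_) hν
    by_cases h : x = b <;> simp [g, h]
  have hY : ∀ i ∈ q, HasSubgaussianMGF (Y i) ((‖(1 / 2 : ℝ) - -(1 / 2)‖₊ / 2) ^ 2) μ := by
    intro i _
    have hmp : μ.map (fun f : I → Bool => f i) = ν :=
      (measurePreserving_eval_infinitePi (fun _ : I => ν) i).map_eq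
    exact HasSubgaussianMGF.of_map (Y := fun f : I → Bool => f i) (X := g)
      (measurable_pi_apply i).aemeasurable (by rw [hmp]; exact hsub)
  have key := HasSubgaussianMGF.measure_sum_ge_le_of_iIndepFun hind hY
    (ε := (q.card : ℝ) / 4) (by positivity)
  have hset : {f : I → Bool | 4 * (q.filter (fun i => f i = b)).card ≤ q.card} =
      {f | (q.card : ℝ) / 4 ≤ ∑ i ∈ q, Y i f} := by
    ext f
    have hs : ∑ i ∈ q, Y i f =
        (q.card : ℝ) / 2 - (q.filter (fun i => f i = b)).card := by
      have : ∀ i ∈ q, Y i f = 1 / 2 - if f i = b then 1 else 0 := by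
        intro i _
        by_cases h : f i = b <;> simp [Y, g, h]; norm_num
      rw [Finset.sum_congr rfl this, Finset.sum_sub_distrib, Finset.sum_boole]
      simp [div_eq_mul_inv]
    simp only [Set.mem_ofPred_eq, hs]
    rw [← Nat.cast_le (α := ℝ)]
    push_cast
    constructor <;> intro h <;> linarith
  rw [hset]
  refine key.trans (le_of_eq ?_)
  congr 1
  have : ((‖(1 / 2 : ℝ) - -(1 / 2)‖₊ / 2) ^ 2 : NNReal) = 1 / 4 := by
    ext
    norm_num
  rw [this]
  rcases Nat.eq_zero_or_pos q.card with h0 | h0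
  · simp [h0]
  · have : (0 : ℝ) < q.card := by exact_mod_cast h0
    simp
    field_simp
    norm_num

open MeasureTheory Filter in
/-- Countably many sequences of finite sets whose sizes grow at least linearly are split
proportionally by a single two-colouring, up to finitely many exceptions in each sequence. -/
theorem exists_balanced_coloring {I J : Type*} [Countable J] (Q : J → ℕ → Finset I)
    (hQ : ∀ j, ∃ c : ℕ, ∀ᶠ n in atTop, n ≤ c * (Q j n).card) :
    ∃ f : I → Bool, ∀ j, ∀ b, ∀ᶠ n in atTop,
      (Q j n).card ≤ 4 * ((Q j n).filter (fun i => f i = b)).card := by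
  obtain ⟨μ, hμ, hexp⟩ := exists_coin_measure I
  have hae : ∀ᵐ f ∂μ, ∀ j, ∀ b, ∀ᶠ n in atTop,
      (Q j n).card ≤ 4 * ((Q j n).filter (fun i => f i = b)).card := by
    rw [ae_all_iff]; intro j
    rw [ae_all_iff]; intro b
    obtain ⟨c, hc⟩ := hQ j
    -- The growth condition is part of the bad event, so that the bound holds for every `n`; in the
    -- exponent, `c + 1` avoids division by zero.
    let s : ℕ → Set (I → Bool) := fun n =>
      {f | n ≤ c * (Q j n).card ∧ 4 * ((Q j n).filter (fun i => f i = b)).card ≤ (Q j n).card}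
    have hs : ∀ n, μ (s n) ≤ ENNReal.ofReal (Real.exp ((n : ℝ) * (-(1 / (8 * (c + 1)))))) := by
      intro n
      by_cases hn : n ≤ c * (Q j n).card
      · rw [← ofReal_measureReal]
        refine ENNReal.ofReal_le_ofReal ?_
        refine ((measureReal_mono (fun f hf => hf.2)).trans (hexp b (Q j n))).trans ?_
        rw [Real.exp_le_exp]
        have hn' : (n : ℝ) ≤ c * (Q j n).card := by exact_mod_cast hn
        have hpos : (0 : ℝ) < 8 * (c + 1) := by positivity
        rw [mul_neg, mul_one_div, neg_div, neg_le_neg_iff, div_le_div_iff₀ hpos (by norm_num)]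
        nlinarith [(Nat.cast_nonneg (Q j n).card : (0 : ℝ) ≤ _)]
      · have : s n = ∅ := by ext f; simp [s, hn]
        simp [this]
    have hsum : Summable fun n : ℕ => Real.exp ((n : ℝ) * (-(1 / (8 * ((c : ℝ) + 1))))) :=
      Real.summable_exp_nat_mul_iff.2 (by rw [neg_lt_zero]; positivity)
    have hfin : (∑' n, μ (s n)) ≠ ⊤ :=
      ne_top_of_le_ne_top hsum.tsum_ofReal_ne_top (ENNReal.tsum_le_tsum hs)
    filter_upwards [ae_eventually_notMem hfin] with f hf
    filter_upwards [hf, hc] with n hn hcn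
    by_contra hlt
    exact hn ⟨hcn, by omega⟩
  exact hae.exists

/-! ### Cells, largeness and one-step extensions -/

/-- The points whose `e`-value lies between `p` and `q`, and that lie in exactly those members of
`s` that belong to `t`. -/
def cell {X : Type*} (e : X → ℝ) (p q : ℚ) (s t : Finset (Set X)) : Set X :=
  {x | (p : ℝ) < e x ∧ e x < q ∧ ∀ A ∈ s, (x ∈ A ↔ A ∈ t)}

/-- The cells cut out by finitely many members of the family `𝒜`. -/
def IsCell {X : Type*} (e : X → ℝ) (𝒜 : Set (Set X)) (U : Set X) : Prop :=
  ∃ p q : ℚ, p < q ∧ ∃ s t : Finset (Set X), (s : Set (Set X)) ⊆ 𝒜 ∧ (t : Set (Set X)) ⊆ 𝒜 ∧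
    U = cell e p q s t

/-- `H` is large on `U`: finite subsets of `H n ∩ U` can be chosen that grow at least linearly
and on which the level is injective, or bounded altogether. -/
def LargeOn {X : Type*} (lvl : X → ℕ) (H : ℕ → Set X) (U : Set X) : Prop :=
  ∃ T : ℕ → Finset X, (∀ n, (T n : Set X) ⊆ H n ∩ U) ∧
    ((∀ n, Set.InjOn lvl (T n)) ∨ ∃ k, ∀ n, ∀ x ∈ T n, lvl x ≤ k) ∧
    ∃ c : ℕ, ∀ᶠ n in Filter.atTop, n ≤ c * (T n).card

/-- A set of subsets (to become clopen) and of sequences of sets (to stay large) is good if all its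
sequences are large on all its cells. -/
def IsGood {X : Type*} (e : X → ℝ) (lvl : X → ℕ) (S : Set (Set X ⊕ (ℕ → Set X))) : Prop :=
  ∀ U, IsCell e (Sum.inl ⁻¹' S) U → ∀ H, Sum.inr H ∈ S → LargeOn lvl H U

section Extension

variable {X : Type*} {e : X → ℝ} {lvl : X → ℕ}

theorem IsCell.mono {𝒜 ℬ : Set (Set X)} (h : 𝒜 ⊆ ℬ) {U : Set X} (hU : IsCell e 𝒜 U) :
    IsCell e ℬ U := by
  obtain ⟨p, q, hpq, s, t, hs, ht, rfl⟩ := hU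
  exact ⟨p, q, hpq, s, t, hs.trans h, ht.trans h, rfl⟩

theorem countable_setOf_isCell {𝒜 : Set (Set X)} (h𝒜 : 𝒜.Countable) :
    {U | IsCell e 𝒜 U}.Countable := by
  classical
  have := h𝒜.to_subtype
  refine (Set.countable_range fun a : (ℚ × ℚ) × Finset 𝒜 × Finset 𝒜 =>
    cell e a.1.1 a.1.2 (a.2.1.map (Function.Embedding.subtype _))
      (a.2.2.map (Function.Embedding.subtype _))).mono ?_
  rintro U ⟨p, q, -, s, t, hs, ht, rfl⟩
  refine ⟨((p, q), s.subtype (· ∈ 𝒜), t.subtype (· ∈ 𝒜)), ?_⟩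
  simp only [Finset.subtype_map]
  rw [Finset.filter_true_of_mem (fun A hA => hs hA), Finset.filter_true_of_mem
    (fun A hA => ht hA)]

/-- Erasing `A` from both finite sets drops a single condition, which was vacuous, `x ∈ A` or `x ∉
A`. -/
theorem IsCell.of_insert {𝒜 : Set (Set X)} {A U : Set X} (hU : IsCell e (insert A 𝒜) U) :
    ∃ V, IsCell e 𝒜 V ∧ (U = V ∨ U = V ∩ A ∨ U = V ∩ Aᶜ) := by
  classical
  obtain ⟨p, q, hpq, s, t, hs, ht, rfl⟩ := hU
  refine ⟨cell e p q (s.erase A) (t.erase A), ⟨p, q, hpq, _, _, ?_, ?_, rfl⟩, ?_⟩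
  · intro B hB
    simp only [Finset.coe_erase, Set.mem_sdiff, Set.mem_singleton_iff] at hB
    exact (hs hB.1).resolve_left hB.2
  · intro B hB
    simp only [Finset.coe_erase, Set.mem_sdiff, Set.mem_singleton_iff] at hB
    exact (ht hB.1).resolve_left hB.2
  · have aux : ∀ x, (∀ B ∈ s, (x ∈ B ↔ B ∈ t)) ↔
        (∀ B ∈ s.erase A, (x ∈ B ↔ B ∈ t.erase A)) ∧ (A ∈ s → (x ∈ A ↔ A ∈ t)) := by
      intro x
      constructor
      · intro h
        refine ⟨fun B hB => ?_, h A⟩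
        have := Finset.mem_erase.1 hB
        simp [this.1, h B this.2]
      · rintro ⟨h1, h2⟩ B hB
        by_cases hBA : B = A
        · subst hBA
          exact h2 hB
        · simpa [hBA] using h1 B (Finset.mem_erase.2 ⟨hBA, hB⟩)
    have hcell : ∀ x, x ∈ cell e p q s t ↔
        x ∈ cell e p q (s.erase A) (t.erase A) ∧ (A ∈ s → (x ∈ A ↔ A ∈ t)) := by
      intro x
      simp only [cell, Set.mem_ofPred_eq, aux x]
      tauto
    by_cases hAs : A ∈ s
    · by_cases hAt : A ∈ t
      · exact Or.inr (Or.inl (Set.ext fun x => by simp [hcell x, hAs, hAt]))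
      · exact Or.inr (Or.inr (Set.ext fun x => by simp [hcell x, hAs, hAt]))
    · exact Or.inl (Set.ext fun x => by simp [hcell x, hAs])

/-- Replace every point of a finite subset `F m` of the level `m` by the label `m`. -/
noncomputable def blockLabel (lvl : X → ℕ) (F : ℕ → Finset X) (x : X) : ℕ ⊕ X :=
  open Classical in if x ∈ F (lvl x) then Sum.inl (lvl x) else Sum.inr x

/-- The sets witnessing largeness can be chosen so that different points have different labels. -/
theorem LargeOn.exists_injOn_blockLabel {H : ℕ → Set X} {U : Set X} (h : LargeOn lvl H U)
    (F : ℕ → Finset X) :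
    ∃ T : ℕ → Finset X, (∀ n, (T n : Set X) ⊆ H n ∩ U) ∧
      ((∀ n, Set.InjOn lvl (T n)) ∨ ∃ k, ∀ n, ∀ x ∈ T n, lvl x ≤ k) ∧
      (∀ n, Set.InjOn (blockLabel lvl F) (T n)) ∧
      ∃ c : ℕ, ∀ᶠ n in Filter.atTop, n ≤ c * (T n).card := by
  classical
  obtain ⟨T, hT, hlvl, c, hc⟩ := h
  -- A block lies under one level, so injective levels give injective labels. Bounded levels involve
  -- finitely many blocks, whose points can be discarded.
  rcases hlvl with hinj | ⟨k, hk⟩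
  · refine ⟨T, hT, Or.inl hinj, fun n x hx y hy hxy => ?_, c, hc⟩
    have := hinj n hx hy
    unfold blockLabel at hxy
    grind
  · refine ⟨fun n => (T n).filter fun x => x ∉ F (lvl x), fun n x hx => hT n ?_,
      Or.inr ⟨k, fun n x hx => hk n x (Finset.mem_filter.1 hx).1⟩, fun n x hx y hy hxy => ?_, ?_⟩
    · exact (Finset.mem_filter.1 hx).1
    · have hx' := (Finset.mem_filter.1 hx).2
      have hy' := (Finset.mem_filter.1 hy).2
      simpa [blockLabel, hx', hy'] using hxy
    · let C := ((Finset.range (k + 1)).biUnion F).card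
      refine ⟨2 * c, ?_⟩
      -- Discarding at most `C` points costs at most `c * C ≤ n / 2`, hence the doubled constant.
      filter_upwards [hc, Filter.eventually_ge_atTop (2 * (c * C))] with n hn hnC
      have h1 : (T n).card ≤ ((T n).filter fun x => x ∉ F (lvl x)).card + C := by
        rw [← Finset.card_filter_add_card_filter_not (s := T n) (fun x => x ∉ F (lvl x))]
        refine Nat.add_le_add_left (Finset.card_le_card fun x hx => ?_) _
        simp only [Finset.mem_filter, not_not] at hx
        exact Finset.mem_biUnion.2
          ⟨lvl x, Finset.mem_range.2 (Nat.lt_succ_of_le (hk n x hx.1)), hx.2⟩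
      have h2 := Nat.mul_le_mul_left c h1
      rw [mul_add] at h2
      rw [mul_assoc]
      omega

/-- A countable good set can be extended by a set that contains or misses each `F m` entirely. -/
theorem IsGood.exists_insert_homogeneous {S : Set (Set X ⊕ (ℕ → Set X))} (hS : IsGood e lvl S)
    (hc : S.Countable) (F : ℕ → Finset X) (hF : ∀ m, ∀ x ∈ F m, lvl x = m) :
    ∃ A : Set X, (∀ m, (F m : Set X) ⊆ A ∨ (F m : Set X) ⊆ Aᶜ) ∧
      IsGood e lvl (insert (Sum.inl A) S) := by
  classical
  have h𝒜 : (Sum.inl ⁻¹' S : Set (Set X)).Countable := hc.preimage Sum.inl_injective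
  have hℋ : (Sum.inr ⁻¹' S : Set (ℕ → Set X)).Countable := hc.preimage Sum.inr_injective
  have := (countable_setOf_isCell (e := e) h𝒜).to_subtype
  have := hℋ.to_subtype
  have hlarge : ∀ j : {U | IsCell e (Sum.inl ⁻¹' S) U} × (Sum.inr ⁻¹' S : Set (ℕ → Set X)),
      LargeOn lvl j.2.1 j.1.1 := fun j => hS _ j.1.2 _ j.2.2
  choose T hT hlvl hinj hcard using fun j => (hlarge j).exists_injOn_blockLabel F
  obtain ⟨f, hf⟩ := exists_balanced_coloring
    (fun j n => (T j n).image (blockLabel lvl F)) (fun j => by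
      obtain ⟨c, hc⟩ := hcard j
      refine ⟨c, hc.mono fun n hn => ?_⟩
      rwa [Finset.card_image_of_injOn (hinj j n)])
  have split : ∀ (j : {U | IsCell e (Sum.inl ⁻¹' S) U} × (Sum.inr ⁻¹' S : Set (ℕ → Set X))) b,
      LargeOn lvl j.2.1 (j.1.1 ∩ {x | f (blockLabel lvl F x) = b}) := by
    intro j b
    refine ⟨fun n => (T j n).filter fun x => f (blockLabel lvl F x) = b, fun n x hx => ?_, ?_, ?_⟩
    · obtain ⟨h1, h2⟩ := Finset.mem_filter.1 hx
      exact ⟨(hT j n h1).1, (hT j n h1).2, h2⟩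
    · exact (hlvl j).imp (fun h n => (h n).mono (Finset.coe_subset.2 (Finset.filter_subset _ _)))
        (fun ⟨k, hk⟩ => ⟨k, fun n x hx => hk n x (Finset.mem_filter.1 hx).1⟩)
    · obtain ⟨c, hc⟩ := hcard j
      refine ⟨c * 4, ?_⟩
      filter_upwards [hc, hf j b] with n hn hfn
      rw [Finset.card_image_of_injOn (hinj j n), Finset.filter_image, Finset.card_image_of_injOn
        ((hinj j n).mono (Finset.coe_subset.2 (Finset.filter_subset _ _)))] at hfn
      calc n ≤ c * (T j n).card := hn
        _ ≤ _ := by rw [mul_assoc]; exact Nat.mul_le_mul_left c hfn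
  refine ⟨{x | f (blockLabel lvl F x) = true}, fun m => ?_, fun U hU H hH => ?_⟩
  · have hlab : ∀ x ∈ F m, blockLabel lvl F x = Sum.inl m := by
      intro x hx
      have := hF m x hx
      subst this
      simp [blockLabel, hx]
    cases hfm : f (Sum.inl m)
    · right
      intro x hx
      simp [hlab x hx, hfm]
    · left
      intro x hx
      simp [hlab x hx, hfm]
  · have hH' : Sum.inr H ∈ S := by simpa using hH
    have hU' : IsCell e (insert {x | f (blockLabel lvl F x) = true} (Sum.inl ⁻¹' S)) U := by
      refine hU.mono fun B hB => ?_
      simpa using hB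
    obtain ⟨V, hV, rfl | rfl | rfl⟩ := hU'.of_insert
    · exact hS _ hV _ hH'
    · exact split (⟨V, hV⟩, ⟨H, hH'⟩) true
    · have : {x | f (blockLabel lvl F x) = true}ᶜ = {x | f (blockLabel lvl F x) = false} := by
        ext x; simp
      rw [this]
      exact split (⟨V, hV⟩, ⟨H, hH'⟩) false

/-- A set that meets every cell meets every cell in an infinite set. -/
theorem IsCell.infinite_inter {𝒜 : Set (Set X)} {D U : Set X}
    (hD : ∀ U, IsCell e 𝒜 U → (U ∩ D).Nonempty) (hU : IsCell e 𝒜 U) : (U ∩ D).Infinite := by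
  obtain ⟨p, q, hpq, s, t, hs, ht, rfl⟩ := hU
  intro hfin
  -- Were the intersection finite, moving the right end `q` close enough to `p` would give a cell
  -- missing `D`.
  have h1 : ∀ᶠ r in nhdsWithin (p : ℝ) (Set.Ioi p), ∀ x ∈ cell e p q s t ∩ D, r < e x := by
    rw [Filter.eventually_all_finite hfin]
    intro x hx
    exact nhdsWithin_le_nhds (eventually_lt_nhds hx.1.1)
  have h2 : ∀ᶠ r in nhdsWithin (p : ℝ) (Set.Ioi p), r < (q : ℝ) :=
    nhdsWithin_le_nhds (eventually_lt_nhds (by exact_mod_cast hpq))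
  obtain ⟨r, hr, hrq, hpr⟩ := (h1.and (h2.and self_mem_nhdsWithin)).exists
  obtain ⟨q', hpq', hq'r⟩ := exists_rat_btwn hpr
  obtain ⟨x, ⟨hx1, hx2, hx3⟩, hxD⟩ :=
    hD (cell e p q' s t) ⟨p, q', by exact_mod_cast hpq', s, t, hs, ht, rfl⟩
  have := hr x ⟨⟨hx1, hx2.trans (hq'r.trans hrq), hx3⟩, hxD⟩
  linarith

/-- From a decreasing sequence of infinite sets one can choose finite subsets of linear growth on
which the level is injective, or bounded altogether. -/
theorem largeOn_of_antitone {D : ℕ → Set X} (hD : Antitone D) {U : Set X}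
    (hinf : ∀ n, (U ∩ D n).Infinite) : LargeOn lvl D U := by
  classical
  -- If levels are bounded on one `U ∩ D n₀`, monotonicity bounds them for all `n ≥ n₀`; otherwise
  -- each `U ∩ D n` has points on infinitely many levels.
  by_cases h : ∃ n₀ k, ∀ x ∈ U ∩ D n₀, lvl x ≤ k
  · obtain ⟨n₀, k, hk⟩ := h
    choose T hT hcard using fun n => (hinf n).exists_subset_card_eq n
    refine ⟨fun n => if n₀ ≤ n then T n else ∅, fun n => ?_, Or.inr ⟨k, fun n x hx => ?_⟩, 1, ?_⟩
    · beta_reduce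
      split_ifs
      · rw [Set.inter_comm]; exact hT n
      · simp
    · beta_reduce at hx
      split_ifs at hx with hn
      · exact hk x ⟨(hT n hx).1, hD hn (hT n hx).2⟩
      · simp at hx
    · filter_upwards [Filter.eventually_ge_atTop n₀] with n hn
      simp [hn, hcard]
  · push Not at h
    have himg : ∀ n, (lvl '' (U ∩ D n)).Infinite := by
      intro n
      refine Set.infinite_of_not_bddAbove ?_
      rintro ⟨k, hk⟩
      obtain ⟨x, hx, hlt⟩ := h n k
      exact absurd (hk ⟨x, hx, rfl⟩) (not_le.2 hlt)
    choose R hR hcard using fun n => (himg n).exists_subset_card_eq n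
    choose T hT hinj himage using fun n =>
      Finset.exists_subset_injOn_image_eq_of_surjOn (f := lvl) (s := U ∩ D n) (t := R n) (hR n)
    refine ⟨T, fun n => ?_, Or.inl hinj, 1, Filter.Eventually.of_forall fun n => ?_⟩
    · rw [Set.inter_comm]; exact hT n
    · rw [← Finset.card_image_of_injOn (hinj n), himage n, hcard, one_mul]

/-- From a decreasing sequence of sets that meet all cells, finite subsets can be chosen that are
large on all cells. -/
theorem exists_finset_largeOn {𝒜 : Set (Set X)} (h𝒜 : 𝒜.Countable) {D : ℕ → Set X}
    (hanti : Antitone D) (hD : ∀ n U, IsCell e 𝒜 U → (U ∩ D n).Nonempty) :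
    ∃ H : ℕ → Finset X, (∀ n, (H n : Set X) ⊆ D n) ∧
      ∀ U, IsCell e 𝒜 U → LargeOn lvl (fun n => (H n : Set X)) U := by
  classical
  have hne : {U | IsCell e 𝒜 U}.Nonempty :=
    ⟨cell e 0 1 ∅ ∅, 0, 1, by norm_num, ∅, ∅, by simp, by simp, rfl⟩
  obtain ⟨u, hu⟩ := (countable_setOf_isCell (e := e) h𝒜).exists_eq_range hne
  have hcell : ∀ i, IsCell e 𝒜 (u i) := fun i => by
    have : u i ∈ {U | IsCell e 𝒜 U} := hu ▸ Set.mem_range_self i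
    exact this
  have hl : ∀ i, LargeOn lvl D (u i) := fun i =>
    largeOn_of_antitone hanti fun n => (hcell i).infinite_inter (hD n)
  choose T hT hlvl hcard using hl
  -- Diagonal union: `H n` serves the first `n` cells, so each cell is neglected for finitely many
  -- `n` only.
  refine ⟨fun n => (Finset.range n).biUnion fun i => T i n, fun n x hx => ?_, fun U hU => ?_⟩
  · obtain ⟨i, -, hi⟩ := Finset.mem_biUnion.1 hx
    exact (hT i n hi).1
  · have : U ∈ Set.range u := hu ▸ hU
    obtain ⟨i, rfl⟩ := this
    refine ⟨fun n => if i < n then T i n else ∅, fun n => ?_, ?_, ?_⟩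
    · beta_reduce
      split_ifs with hin
      · exact fun x hx => ⟨Finset.mem_biUnion.2 ⟨i, Finset.mem_range.2 hin, hx⟩, (hT i n hx).2⟩
      · simp
    · refine (hlvl i).imp (fun h n => ?_) (fun ⟨k, hk⟩ => ⟨k, fun n x hx => ?_⟩)
      · beta_reduce
        split_ifs
        · exact h n
        · simp
      · beta_reduce at hx
        split_ifs at hx
        · exact hk n x hx
        · simp at hx
    · obtain ⟨c, hc⟩ := hcard i
      refine ⟨c, ?_⟩
      filter_upwards [hc, Filter.eventually_gt_atTop i] with n hn hin
      simpa [hin] using hn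

end Extension

/-! ### Transfinite recursion -/

/-- Transfinite construction of length at most `ω₁`: if every countable good set can be extended
to a countable good set with any one of at most `ℵ₁` monotone properties, and unions of chains of
good sets are good, then some good set has all these properties. -/
theorem exists_good_of_countable_extensions {α τ : Type*} (hτ : Cardinal.mk τ ≤ Cardinal.aleph 1)
    (G : Set α → Prop) (R : τ → Set α → Prop)
    (hmono : ∀ t S S', S ⊆ S' → R t S → R t S')
    (hunion : ∀ 𝒞 : Set (Set α), 𝒞.Nonempty → IsChain (· ⊆ ·) 𝒞 → (∀ S ∈ 𝒞, G S) → G (⋃₀ 𝒞))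
    {S₀ : Set α} (hS₀ : S₀.Countable) (hG₀ : G S₀)
    (hext : ∀ t S, S.Countable → G S → ∃ S', S ⊆ S' ∧ S'.Countable ∧ G S' ∧ R t S') :
    ∃ S, S₀ ⊆ S ∧ G S ∧ ∀ t, R t S := by
  classical
  -- A well-order of least type: its proper initial segments have size below `ℵ₁`, so every stage
  -- stays countable.
  obtain ⟨r, hwo, hr⟩ := Cardinal.exists_ord_eq τ
  have hcount : ∀ t, {s | r s t}.Countable := by
    intro t
    have h := (Cardinal.card_typein_lt (r := r) t hr).trans_le hτ
    rw [← Cardinal.le_aleph0_iff_set_countable, ← Order.lt_succ_iff, Cardinal.succ_aleph0]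
    exact h
  choose! ext hsub hcnt hgood hR using hext
  let base : (t : τ) → ((s : τ) → r s t → Set α) → Set α := fun t f => S₀ ∪ ⋃ s, ⋃ h : r s t, f s h
  let seq : τ → Set α := hwo.wf.fix fun t f => ext t (base t f)
  have hseq : ∀ t, seq t = ext t (S₀ ∪ ⋃ s, ⋃ _ : r s t, seq s) := fun t => hwo.wf.fix_eq _ t
  have hchain : ∀ P : Set τ, (∀ t ∈ P, (S₀ ∪ ⋃ s, ⋃ _ : r s t, seq s) ⊆ seq t ∧ G (seq t)) →
      G (S₀ ∪ ⋃ s ∈ P, seq s) := by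
    intro P hP
    have heq : S₀ ∪ ⋃ s ∈ P, seq s = ⋃₀ (insert S₀ (seq '' P)) := by
      simp [Set.sUnion_insert, Set.sUnion_image]
    rw [heq]
    have hlt : ∀ s t, t ∈ P → r s t → seq s ⊆ seq t := fun s t ht hst =>
      (Set.subset_union_of_subset_right (Set.subset_iUnion₂_of_subset s hst le_rfl) _).trans
        (hP t ht).1
    refine hunion _ (Set.insert_nonempty _ _) (IsChain.insert ?_ ?_) ?_
    · rintro _ ⟨s, hs, rfl⟩ _ ⟨t, ht, rfl⟩ hne
      rcases trichotomous_of r s t with h | h | h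
      · exact Or.inl (hlt s t ht h)
      · exact absurd (congrArg seq h) hne
      · exact Or.inr (hlt t s hs h)
    · rintro _ ⟨t, ht, rfl⟩ -
      exact Or.inl (Set.subset_union_left.trans (hP t ht).1)
    · rintro S (rfl | ⟨t, ht, rfl⟩)
      · exact hG₀
      · exact (hP t ht).2
  have main : ∀ t, (seq t).Countable ∧ ((S₀ ∪ ⋃ s, ⋃ _ : r s t, seq s) ⊆ seq t ∧ G (seq t)) ∧
      R t (seq t) := by
    intro t
    induction t using hwo.wf.induction with
    | _ t ih =>
      have hc : (S₀ ∪ ⋃ s, ⋃ _ : r s t, seq s).Countable :=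
        hS₀.union ((hcount t).biUnion fun s hs => (ih s hs).1)
      have hg : G (S₀ ∪ ⋃ s, ⋃ _ : r s t, seq s) := hchain {s | r s t} fun s hs => (ih s hs).2.1
      rw [hseq t]
      exact ⟨hcnt t _ hc hg, ⟨hsub t _ hc hg, hgood t _ hc hg⟩, hR t _ hc hg⟩
  refine ⟨S₀ ∪ ⋃ s ∈ (Set.univ : Set τ), seq s, Set.subset_union_left,
    hchain _ fun t _ => (main t).2.1, fun t => hmono t _ _ ?_ (main t).2.2⟩
  exact fun x hx => Or.inr (Set.mem_iUnion₂.2 ⟨t, Set.mem_univ t, hx⟩)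

/-! ### The saturated good set and its topology -/

section Family

variable {X : Type} {e : X → ℝ} {lvl : X → ℕ}

/-- Goodness is finitary: a cell and a sequence involve finitely many members, all found in one set
of the chain. -/
theorem isGood_sUnion {𝒞 : Set (Set (Set X ⊕ (ℕ → Set X)))} (hne : 𝒞.Nonempty)
    (hchain : IsChain (· ⊆ ·) 𝒞) (hgood : ∀ S ∈ 𝒞, IsGood e lvl S) : IsGood e lvl (⋃₀ 𝒞) := by
  classical
  rintro U ⟨p, q, hpq, s, t, hs, ht, rfl⟩ H hH
  have hfin : ((Sum.inl '' (s : Set (Set X)) ∪ Sum.inl '' (t : Set (Set X))) ∪ {Sum.inr H} :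
      Set (Set X ⊕ (ℕ → Set X))).Finite :=
    ((s.finite_toSet.image _).union (t.finite_toSet.image _)).union (Set.finite_singleton _)
  obtain ⟨S, hS, hsub⟩ := hchain.directedOn.exists_mem_subset_of_finite_of_subset_sUnion hne hfin
    (by
      rintro x ((⟨A, hA, rfl⟩ | ⟨A, hA, rfl⟩) | rfl)
      · exact hs hA
      · exact ht hA
      · exact hH)
  exact hgood S hS _ ⟨p, q, hpq, s, t, fun A hA => hsub (Or.inl (Or.inl ⟨A, hA, rfl⟩)),
    fun A hA => hsub (Or.inl (Or.inr ⟨A, hA, rfl⟩)), rfl⟩ H (hsub (Or.inr rfl))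

theorem mk_sequences_le_continuum [Countable X] :
    Cardinal.mk ((ℕ → Set X) ⊕ (ℕ → Finset X)) ≤ Cardinal.continuum := by
  have h1 : Cardinal.mk (ℕ → Set X) ≤ Cardinal.continuum := by
    have : Cardinal.mk (Set X) ≤ Cardinal.continuum := by
      rw [Cardinal.mk_set, ← Cardinal.two_power_aleph0]
      exact Cardinal.power_le_power_left two_ne_zero Cardinal.mk_le_aleph0
    calc Cardinal.mk (ℕ → Set X) = Cardinal.mk (Set X) ^ Cardinal.aleph0 := by simp
      _ ≤ Cardinal.continuum ^ Cardinal.aleph0 := Cardinal.power_le_power_right this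
      _ = Cardinal.continuum := Cardinal.continuum_power_aleph0
  have h2 : Cardinal.mk (ℕ → Finset X) ≤ Cardinal.continuum :=
    (Cardinal.mk_le_of_injective (f := fun (F : ℕ → Finset X) n => (F n : Set X))
      fun F F' h => funext fun n => Finset.coe_injective (congrFun h n)).trans h1
  rw [Cardinal.mk_sum, Cardinal.lift_id, Cardinal.lift_id]
  exact (add_le_add h1 h2).trans Cardinal.continuum_add_self.le

/-- Under CH there is a good set that deals with all decreasing sequences that meet all cells and
with all selectors of finite sets from the levels. -/
theorem exists_isGood_saturated (CH : Cardinal.continuum.{0} = Cardinal.aleph.{0} 1) [Countable X]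
    (hdense : ∀ m, ∀ p q : ℚ, p < q → ∃ x, lvl x = m ∧ (p : ℝ) < e x ∧ e x < q) :
    ∃ S : Set (Set X ⊕ (ℕ → Set X)), IsGood e lvl S ∧
      (∀ m, Sum.inr (fun _ => {x | lvl x = m}) ∈ S) ∧
      (∀ D : ℕ → Set X, Antitone D →
        (∀ n U, IsCell e (Sum.inl ⁻¹' S) U → (U ∩ D n).Nonempty) →
        ∃ H : ℕ → Finset X, (∀ n, (H n : Set X) ⊆ D n) ∧ Sum.inr (fun n => (H n : Set X)) ∈ S) ∧
      (∀ F : ℕ → Finset X, (∀ m, ∀ x ∈ F m, lvl x = m) →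
        ∃ A, Sum.inl A ∈ S ∧ ∀ m, (F m : Set X) ⊆ A ∨ (F m : Set X) ⊆ Aᶜ) := by
  let R : ((ℕ → Set X) ⊕ (ℕ → Finset X)) → Set (Set X ⊕ (ℕ → Set X)) → Prop := fun t S =>
    Sum.elim
      (fun D => Antitone D → (∀ n U, IsCell e (Sum.inl ⁻¹' S) U → (U ∩ D n).Nonempty) →
        ∃ H : ℕ → Finset X, (∀ n, (H n : Set X) ⊆ D n) ∧ Sum.inr (fun n => (H n : Set X)) ∈ S)
      (fun F => (∀ m, ∀ x ∈ F m, lvl x = m) →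
        ∃ A, Sum.inl A ∈ S ∧ ∀ m, (F m : Set X) ⊆ A ∨ (F m : Set X) ⊆ Aᶜ) t
  let S₀ : Set (Set X ⊕ (ℕ → Set X)) := Set.range fun m => Sum.inr fun _ => {x | lvl x = m}
  have hG₀ : IsGood e lvl S₀ := by
    have hempty : (Sum.inl ⁻¹' S₀ : Set (Set X)) = ∅ := by
      ext A
      simp [S₀]
    rintro U hU H ⟨m, hm⟩
    obtain rfl := Sum.inr_injective hm
    refine largeOn_of_antitone antitone_const fun _ => hU.infinite_inter ?_
    rintro V ⟨p, q, hpq, s, t, hs, -, rfl⟩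
    obtain ⟨x, hx, hp, hq⟩ := hdense m p q hpq
    exact ⟨x, ⟨hp, hq, fun A hA => absurd (hs hA) (by simp [hempty])⟩, hx⟩
  -- Enlarging `S` adds cells, so the premise that `D n` meets all cells only becomes stronger.
  have hmono : ∀ t S S', S ⊆ S' → R t S → R t S' := by
    rintro (D | F) S S' hSS' h
    · intro hD hmeet
      obtain ⟨H, hH, hHS⟩ := h hD fun n U hU => hmeet n U (hU.mono (Set.preimage_mono hSS'))
      exact ⟨H, hH, hSS' hHS⟩
    · intro hF
      obtain ⟨A, hA, hAF⟩ := h hF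
      exact ⟨A, hSS' hA, hAF⟩
  have hext : ∀ t S, S.Countable → IsGood e lvl S →
      ∃ S', S ⊆ S' ∧ S'.Countable ∧ IsGood e lvl S' ∧ R t S' := by
    rintro (D | F) S hc hS
    · by_cases h : Antitone D ∧ ∀ n U, IsCell e (Sum.inl ⁻¹' S) U → (U ∩ D n).Nonempty
      · obtain ⟨H, hH, hl⟩ := exists_finset_largeOn (lvl := lvl)
          (hc.preimage Sum.inl_injective) h.1 h.2
        refine ⟨insert (Sum.inr fun n => (H n : Set X)) S, Set.subset_insert _ _, hc.insert _, ?_,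
          fun _ _ => ⟨H, hH, Set.mem_insert _ _⟩⟩
        intro U hU H' hH'
        have hU' : IsCell e (Sum.inl ⁻¹' S) U := hU.mono fun A hA => by simpa using hA
        rcases hH' with h' | h'
        · rw [Sum.inr_injective h']
          exact hl U hU'
        · exact hS U hU' H' h'
      · exact ⟨S, le_rfl, hc, hS, fun h1 h2 => absurd ⟨h1, h2⟩ h⟩
    · by_cases h : ∀ m, ∀ x ∈ F m, lvl x = m
      · obtain ⟨A, hA, hg⟩ := hS.exists_insert_homogeneous hc F h
        exact ⟨_, Set.subset_insert _ _, hc.insert _, hg, fun _ => ⟨A, Set.mem_insert _ _, hA⟩⟩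
      · exact ⟨S, le_rfl, hc, hS, fun h' => absurd h' h⟩
  obtain ⟨S, hsub, hgood, hR⟩ := exists_good_of_countable_extensions
    (mk_sequences_le_continuum.trans CH.le) (IsGood e lvl) R hmono (fun _ => isGood_sUnion)
    (Set.countable_range _ : S₀.Countable) hG₀ hext
  exact ⟨S, hgood, fun m => hsub ⟨m, rfl⟩, fun D => hR (Sum.inl D), fun F => hR (Sum.inr F)⟩

/-- The topology generated by an injection into the reals and a family of sets made clopen. -/
theorem exists_topology_of_cells (he : Function.Injective e) (𝒜 : Set (Set X)) :
    ∃ _ : TopologicalSpace X, T3Space X ∧ (∀ U, IsCell e 𝒜 U → IsOpen U) ∧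
      (∀ A ∈ 𝒜, IsClopen A) ∧
      ∀ U : Set X, IsOpen U → ∀ x ∈ U, ∃ V, IsCell e 𝒜 V ∧ x ∈ V ∧ V ⊆ U := by
  classical
  -- The topology is induced from a product of ℝ and a Cantor cube, which makes it regular;
  -- injectivity of `e` makes it Hausdorff.
  let g : X → ℝ × (𝒜 → Bool) := fun x => (e x, fun A => decide (x ∈ A.1))
  let τ : TopologicalSpace X := TopologicalSpace.induced g inferInstance
  have hind : Topology.IsInducing g := ⟨rfl⟩
  have hg : Continuous g := hind.continuous
  have hecont : Continuous e := continuous_fst.comp hg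
  have hclopen : ∀ A ∈ 𝒜, IsClopen A := by
    intro A hA
    have hc : Continuous fun x : X => decide (x ∈ A) :=
      (continuous_apply (⟨A, hA⟩ : 𝒜)).comp (continuous_snd.comp hg)
    have : A = (fun x : X => decide (x ∈ A)) ⁻¹' {true} := by
      ext x
      simp
    rw [this]
    exact (isClopen_discrete _).preimage hc
  have : RegularSpace X := hind.regularSpace
  have : T2Space X := T2Space.of_injective_continuous he hecont
  refine ⟨τ, {}, ?_, hclopen, ?_⟩
  · rintro U ⟨p, q, -, s, t, hs, -, rfl⟩
    have heq : cell e p q s t = e ⁻¹' Set.Ioo (p : ℝ) q ∩ ⋂ A ∈ s, {x | x ∈ A ↔ A ∈ t} := by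
      ext x
      simp [cell, and_assoc]
    rw [heq]
    refine (isOpen_Ioo.preimage hecont).inter (isOpen_biInter_finset fun A hA => ?_)
    by_cases hAt : A ∈ t
    · simpa [hAt] using (hclopen A (hs hA)).isOpen
    · simpa [hAt, Set.compl_def] using (hclopen A (hs hA)).compl.isOpen
  · intro U hU x hx
    obtain ⟨W, hW, rfl⟩ := isOpen_induced_iff.1 hU
    obtain ⟨u, v, hu, hv, hxu, hxv, huv⟩ := isOpen_prod_iff.1 hW _ _ hx
    obtain ⟨I, w, hw, hIw⟩ := isOpen_pi_iff.1 hv _ hxv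
    obtain ⟨a, b, ⟨hax, hxb⟩, hab⟩ := mem_nhds_iff_exists_Ioo_subset.1 (hu.mem_nhds hxu)
    obtain ⟨p, hap, hpx⟩ := exists_rat_btwn hax
    obtain ⟨q, hxq, hqb⟩ := exists_rat_btwn hxb
    let s : Finset (Set X) := I.map (Function.Embedding.subtype _)
    have hs : (s : Set (Set X)) ⊆ 𝒜 := by
      intro A hA
      obtain ⟨B, -, rfl⟩ := Finset.mem_map.1 hA
      exact B.2
    refine ⟨cell e p q s (s.filter (x ∈ ·)), ⟨p, q, by exact_mod_cast hpx.trans hxq, s, _, hs,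
      fun A hA => hs (Finset.mem_filter.1 hA).1, rfl⟩, ⟨hpx, hxq, fun A hA => by simp [hA]⟩, ?_⟩
    rintro y ⟨hpy, hyq, hy⟩
    refine huv ⟨hab ⟨hap.trans hpy, hyq.trans hqb⟩, hIw fun B hB => ?_⟩
    have hBs : B.1 ∈ s := Finset.mem_map.2 ⟨B, hB, rfl⟩
    have hyB : y ∈ B.1 ↔ x ∈ B.1 := by simpa [hBs] using hy B.1 hBs
    have : decide (y ∈ B.1) = decide (x ∈ B.1) := by simp [hyB]
    exact Set.mem_of_eq_of_mem this (hw B hB).2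

theorem LargeOn.eventually_nonempty {H : ℕ → Set X} {U : Set X} (h : LargeOn lvl H U) :
    ∀ᶠ n in Filter.atTop, (U ∩ H n).Nonempty := by
  obtain ⟨T, hT, -, c, hc⟩ := h
  filter_upwards [hc, Filter.eventually_gt_atTop 0] with n hn h0
  have : (T n).Nonempty := by
    rw [← Finset.card_pos]
    by_contra hz
    have : (T n).card = 0 := by omega
    rw [this] at hn
    omega
  obtain ⟨x, hx⟩ := this
  exact ⟨x, (hT n hx).2, (hT n hx).1⟩

end Family

/-! ### Relations between the separability notions -/

theorem MonoSSeparableAlong.mono {ℱ 𝒢 : Filter ℕ} (h : 𝒢 ≤ ℱ) {X : Type*} [TopologicalSpace X]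
    (hX : MonoSSeparableAlong ℱ X) : MonoSSeparableAlong 𝒢 X := by
  intro D hD hdense
  obtain ⟨F, hF, hU⟩ := hX D hD hdense
  exact ⟨F, hF, fun U ho hne => h (hU U ho hne)⟩

theorem MonoSSeparableAlong.monoSSeparable {ℱ : Filter ℕ} [ℱ.NeBot] {X : Type*}
    [TopologicalSpace X] (hX : MonoSSeparableAlong ℱ X) : MonoSSeparable X := by
  intro D hD hdense
  obtain ⟨F, hF, hcatch⟩ := hX D hD hdense
  refine ⟨F, hF, fun k U hU => ?_⟩
  have : ∀ᶠ n in ℱ, ∀ i, (U i ∩ (F n : Set X)).Nonempty :=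
    Filter.eventually_all.2 fun i => hcatch (U i) (hU i).1 (hU i).2
  exact this.exists

/-- The tail unions `⋃ m ≥ n, D m` decrease. A point chosen from the `n`-th one lies in some `D m`
with `m ≥ n` and is reassigned to that `m`; each `m` receives points from finitely many `F n` only.
-/
theorem MonoSSeparable.mSeparable {X : Type*} [TopologicalSpace X] (hX : MonoSSeparable X) :
    MSeparable X := by
  classical
  intro D hD
  obtain ⟨F, hF, hcatch⟩ := hX (fun n => ⋃ m, ⋃ _ : n ≤ m, D m)
    (fun a b hab => Set.iUnion_mono fun m => Set.iUnion_mono' fun h => ⟨hab.trans h, le_rfl⟩)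
    (fun n => (hD n).mono (Set.subset_iUnion₂_of_subset n le_rfl le_rfl))
  refine ⟨fun m => ((Finset.range (m + 1)).biUnion F).filter (· ∈ D m),
    fun m x hx => (Finset.mem_filter.1 hx).2, ?_⟩
  rw [dense_iff_inter_open]
  intro U hU hne
  obtain ⟨n, hn⟩ := hcatch 1 (fun _ => U) fun _ => ⟨hU, hne⟩
  obtain ⟨x, hxU, hxF⟩ := hn 0
  obtain ⟨m, hnm, hxm⟩ := Set.mem_iUnion₂.1 (hF n hxF)
  refine ⟨x, hxU, Set.mem_iUnion.2 ⟨m, Finset.mem_filter.2 ⟨?_, hxm⟩⟩⟩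
  exact Finset.mem_biUnion.2 ⟨n, Finset.mem_range.2 (Nat.lt_succ_of_le hnm), hxF⟩

/-! ### The space -/

/-- Under CH there is a countable crowded regular space that is not `S`-separable although finite
subsets of the members of any decreasing sequence of dense sets can be chosen such that every
non-empty open set meets all but finitely many of them. -/
theorem exists_monoSSeparableAlong_cofinite_not_sSeparable
    (CH : Cardinal.continuum.{0} = Cardinal.aleph.{0} 1) :
    ∃ (X : Type) (_ : TopologicalSpace X), Countable X ∧ T3Space X ∧
      (∀ x : X, ¬ IsOpen ({x} : Set X)) ∧
      MonoSSeparableAlong Filter.cofinite X ∧ ¬ SSeparable X := by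
  obtain ⟨X, hX, e, lvl, he, hdense⟩ : ∃ (X : Type) (_ : Countable X) (e : X → ℝ) (lvl : X → ℕ),
      Function.Injective e ∧
      ∀ m, ∀ p q : ℚ, p < q → ∃ x, lvl x = m ∧ (p : ℝ) < e x ∧ e x < q := by
    -- The levels are the translates `ℚ + m√2`, dense in ℝ and pairwise disjoint because `√2` is
    -- irrational.
    refine ⟨ℕ × ℚ, inferInstance, fun x => x.2 + x.1 * √2, Prod.fst, ?_, ?_⟩
    · rintro ⟨m, p⟩ ⟨n, q⟩ h
      simp only at h
      have hmn : m = n := by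
        by_contra hne
        have hne' : (m : ℝ) - n ≠ 0 := sub_ne_zero.2 (by exact_mod_cast hne)
        refine irrational_sqrt_two ⟨(q - p) / (m - n), ?_⟩
        push_cast
        rw [div_eq_iff hne']
        linarith
      subst hmn
      have : (p : ℝ) = q := by linarith
      rw [Rat.cast_injective this]
    · intro m p q hpq
      have hpq' : (p : ℝ) - m * √2 < q - m * √2 :=
        sub_lt_sub_right (by exact_mod_cast hpq) _
      obtain ⟨r, h1, h2⟩ := exists_rat_btwn hpq'
      exact ⟨(m, r), rfl, by simp only; linarith, by simp only; linarith⟩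
  obtain ⟨S, hgood, hlvl, hD, hF⟩ := exists_isGood_saturated CH hdense
  obtain ⟨τ, hT3, hopen, hclopen, hbasis⟩ := exists_topology_of_cells he (Sum.inl ⁻¹' S)
  have hsub : ∀ U : Set X, IsOpen U → U.Nonempty → ∃ V, IsCell e (Sum.inl ⁻¹' S) V ∧ V ⊆ U := by
    rintro U hU ⟨x, hx⟩
    obtain ⟨V, hV, -, hVU⟩ := hbasis U hU x hx
    exact ⟨V, hV, hVU⟩
  have hmeet : ∀ m V, IsCell e (Sum.inl ⁻¹' S) V → (V ∩ {x | lvl x = m}).Nonempty :=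
    fun m V hV => (hgood V hV _ (hlvl m)).eventually_nonempty.exists.choose_spec
  have hlvldense : ∀ m, Dense {x | lvl x = m} := by
    intro m
    rw [dense_iff_inter_open]
    intro U hU hne
    obtain ⟨V, hV, hVU⟩ := hsub U hU hne
    exact (hmeet m V hV).mono (Set.inter_subset_inter_left _ hVU)
  refine ⟨X, τ, hX, hT3, fun x hx => ?_, fun D hanti hdense => ?_, fun hS => ?_⟩
  · obtain ⟨V, hV, hVx⟩ := hsub {x} hx ⟨x, rfl⟩
    exact hV.infinite_inter (hmeet 0) ((Set.finite_singleton x).subset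
      (Set.inter_subset_left.trans hVx))
  · obtain ⟨H, hH, hHS⟩ := hD D hanti fun n V hV => by
      have hne : V.Nonempty := (hmeet 0 V hV).left
      exact (hdense n).inter_open_nonempty V (hopen V hV) hne
    refine ⟨H, hH, fun U hU hne => ?_⟩
    obtain ⟨V, hV, hVU⟩ := hsub U hU hne
    rw [Nat.cofinite_eq_atTop]
    exact (hgood V hV _ hHS).eventually_nonempty.mono fun n hn =>
      hn.mono (Set.inter_subset_inter_left _ hVU)
  · obtain ⟨F, hFsub, hcatch⟩ := hS _ hlvldense
    obtain ⟨A, hAS, hA⟩ := hF F fun m x hx => hFsub m hx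
    -- Both `t = {A}` and `t = ∅` give cells, so neither `A` nor `Aᶜ` is empty.
    have hcellA : ∀ t : Finset (Set X), (t : Set (Set X)) ⊆ {A} → (cell e 0 1 {A} t).Nonempty :=
      fun t ht => (hmeet 0 _ ⟨0, 1, by norm_num, {A}, t, by simpa using hAS,
        fun B hB => by rw [ht hB]; exact hAS, rfl⟩).left
    have hne : A.Nonempty := by
      obtain ⟨x, -, -, hx⟩ := hcellA {A} (by simp)
      exact ⟨x, by simpa using hx A⟩
    have hnec : Aᶜ.Nonempty := by
      obtain ⟨x, -, -, hx⟩ := hcellA ∅ (by simp)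
      exact ⟨x, by simpa using hx A⟩
    obtain ⟨n, hn⟩ := hcatch 2 ![A, Aᶜ] (by
      intro i
      fin_cases i
      · exact ⟨(hclopen A hAS).isOpen, hne⟩
      · exact ⟨(hclopen A hAS).compl.isOpen, hnec⟩)
    obtain ⟨x, hxA, hxF⟩ := hn 0
    obtain ⟨y, hyA, hyF⟩ := hn 1
    rcases hA n with h | h
    · exact hyA (h hyF)
    · exact h hxF hxA

theorem theorem3p1 (CH : Cardinal.continuum.{0} = Cardinal.aleph.{0} 1) :
    (∀ 𝒢 : Ultrafilter ℕ, IsSelective 𝒢 →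
      ∃ (X : Type) (_ : TopologicalSpace X), Countable X ∧ T3Space X ∧
        (∀ x : X, ¬ IsOpen ({x} : Set X)) ∧
        MonoSSeparableAlong (𝒢 : Filter ℕ) X ∧ ¬ SSeparable X) ∧
    (∃ (X : Type) (_ : TopologicalSpace X), Countable X ∧ T3Space X ∧
        (∀ x : X, ¬ IsOpen ({x} : Set X)) ∧
        MonoSSeparable X ∧ MSeparable X ∧ ¬ SSeparable X) := by
  obtain ⟨X, τ, hX, hT3, hiso, hsep, hS⟩ := exists_monoSSeparableAlong_cofinite_not_sSeparable CH
  -- A free ultrafilter contains all cofinite sets, so separability along the cofinite filter passes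
  -- to `𝒢`.
  exact ⟨fun 𝒢 h𝒢 => ⟨X, τ, hX, hT3, hiso, hsep.mono h𝒢.1, hS⟩,
    X, τ, hX, hT3, hiso, hsep.monoSSeparable, hsep.monoSSeparable.mSeparable, hS⟩
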